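/- Let $H$ be a separable complex Hilbert space, let $\mathcal D\subseteq\mathcal B(H)$ be a unital $C^*$-subalgebra (norm closed, containing the identity $I$ of $H$), and let $(p_n)_{n=1}^\infty\subseteq\mathcal D$ be an increasing sequence of projections with $\bigvee_n p_n=I$. Put $H_n=p_nH$ and $\mathcal D_n=p_n\mathcal Dp_n$, and identify $\mathcal B(H_n)$ and the space $\mathcal K(H_n)$ of compact operators on $H_n$ with $p_n\mathcal B(H)p_n$ and $p_n\mathcal K(H)p_n$, respectively. Let $$\Phi:\bigcup_{n=1}^\infty\mathcal K(H_n)\to\bigcup_{n=1}^\infty\mathcal B(H_n)$$ be a map such that, for every $n$, the restriction $\Phi|_{\mathcal K(H_n)}$ is a completely positive linear map into $\mathcal B(H_n)$ (that is, $\sum_{k,l=1}^m(\Phi(a_k^*a_l)\xi_l,\xi_k)\ge 0$ for all $m$, all $a_1,\dots,a_m\in\mathcal K(H_n)$ and all $\xi_1,\dots,\xi_m\in H_n$) and is $\mathcal D_n$-bimodular (that is, $\Phi(dxe)=d\,\Phi(x)\,e$ for $d,e\in\mathcal D_n$, $x\in\mathcal K(H_n)$). Then there exists a sequence $(a_i)_{i=1}^\infty$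 of densely defined closable operators on $H$, affiliated with the commutant $\mathcal D'$ (that is, the closure $\overline{a_i}$ satisfies $y\,\overline{a_i}\subseteq\overline{a_i}\,y$ for every $y\in\mathcal D''$), such that $$\Phi(x)=\sum_{i=1}^\infty a_i^*xa_i,\qquad x\in\bigcup_{n=1}^\infty\mathcal K(H_n).$$ Here, for each such $x$ and each $i$, the operator $x a_i$ maps the domain of $a_i$ into the domain of $a_i^*$, the operator $a_i^*xa_i$ extends to a bounded operator on $H$, and the series of these bounded operators converges to $\Phi(x)$ in the weak* topology of $\mathcal B(H)$. Moreover, for all $i$ and $n$, the domain of $a_i$ contains $H_n$ and $a_ip_n\in\mathcal D'p_n$. -/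

import Mathlib

open scoped ComplexOrder LinearPMap

section

variable {H : Type*} [NormedAddCommGroup H] [InnerProductSpace ℂ H] [CompleteSpace H]

/-- For a projection `p`, the space of bounded operators on the subspace `pH`, identified as usual
with the corner `p B(H) p` of `B(H)`. -/
def boundedCorner (p : H →L[ℂ] H) : Set (H →L[ℂ] H) :=
  {x | p * x * p = x}

/-- For a projection `p`, the space of compact operators on the subspace `pH`, identified as usual
with the corner `p K(H) p` of `B(H)`. -/
def compactCorner (p : H →L[ℂ] H) : Set (H →L[ℂ] H) :=
  {x | IsCompactOperator x ∧ p * x * p = x}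

/-- The compressed algebra `p D p`. -/
def compressedAlgebra (D : StarSubalgebra ℂ (H →L[ℂ] H)) (p : H →L[ℂ] H) : Set (H →L[ℂ] H) :=
  {y | ∃ d ∈ D, y = p * d * p}

/-- The commutant `D'` of a unital self-adjoint algebra of operators, as a von Neumann algebra. -/
noncomputable def commutantVN (D : StarSubalgebra ℂ (H →L[ℂ] H)) : VonNeumannAlgebra H where
  toStarSubalgebra := StarSubalgebra.centralizer ℂ (D : Set (H →L[ℂ] H))
  centralizer_centralizer' := by
    have h : ((StarSubalgebra.centralizer ℂ (D : Set (H →L[ℂ] H))).carrier) =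
        Set.centralizer ((D : Set (H →L[ℂ] H)) ∪ star (D : Set (H →L[ℂ] H))) := rfl
    rw [h, Set.centralizer_centralizer_centralizer]

theorem mem_commutantVN_iff {D : StarSubalgebra ℂ (H →L[ℂ] H)} {c : H →L[ℂ] H} :
    c ∈ commutantVN D ↔ ∀ d ∈ D, d * c = c * d := by
  have h : c ∈ commutantVN D ↔ c ∈ StarSubalgebra.centralizer ℂ (D : Set (H →L[ℂ] H)) := Iff.rfl
  rw [h, StarSubalgebra.mem_centralizer_iff]
  constructor
  · intro hc d hd
    exact (hc d hd).1
  · intro hc d hd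
    exact ⟨hc d hd, hc (star d) (star_mem hd)⟩

/-- `Φ` restricted to `K(pH)` is a completely positive linear map into the operators on `pH`:
it is linear on `K(pH)` and `∑ k, l, (Φ(a_k* a_l) ξ_l, ξ_k) ≥ 0` for all finite families `a_k` in
`K(pH)` and `ξ_k` in `pH`. (The inner product `(u, v)`, linear in `u`, is `inner ℂ v u`; the order
on `ℂ` is the one for which `0 ≤ z` means that `z` is a nonnegative real number.) -/
structure IsCompletelyPositiveOn (Φ : (H →L[ℂ] H) → (H →L[ℂ] H)) (p : H →L[ℂ] H) : Prop where
  mapsTo : Set.MapsTo Φ (compactCorner p) (boundedCorner p)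
  map_add : ∀ x ∈ compactCorner p, ∀ y ∈ compactCorner p, Φ (x + y) = Φ x + Φ y
  map_smul : ∀ (c : ℂ), ∀ x ∈ compactCorner p, Φ (c • x) = c • Φ x
  nonneg : ∀ (m : ℕ) (a : Fin m → (H →L[ℂ] H)) (ξ : Fin m → H),
    (∀ k, a k ∈ compactCorner p) → (∀ k, p (ξ k) = ξ k) →
      0 ≤ ∑ k, ∑ l, inner ℂ (ξ k) (Φ (star (a k) * a l) (ξ l))

/-- `Φ` restricted to `S` is a bimodule map over `A`. -/
def IsBimodularOn (Φ : (H →L[ℂ] H) → (H →L[ℂ] H)) (A S : Set (H →L[ℂ] H)) : Prop :=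
  ∀ d ∈ A, ∀ e ∈ A, ∀ x ∈ S, Φ (d * x * e) = d * Φ x * e

/-- A densely defined closable operator `T` is affiliated with the von Neumann algebra `M` if its
closure `T̄` satisfies `y T̄ ⊆ T̄ y` for every `y` in the commutant `M'`. -/
structure IsAffiliated (M : VonNeumannAlgebra H) (T : H →ₗ.[ℂ] H) : Prop where
  dense : Dense (T.domain : Set H)
  closable : T.IsClosable
  commutes : ∀ y ∈ M.commutant, ∀ ξ : T.closure.domain,
    ∃ h : y (ξ : H) ∈ T.closure.domain, T.closure ⟨y ξ, h⟩ = y (T.closure ξ)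

/-- The bounded operator `t` extends the (possibly not everywhere defined) operator `a* x a`, where
the domain of `a* x a` is the whole domain of `a`. When `a` is densely defined, `t` is uniquely
determined: it is the operator `a* x a` extended by continuity to `H`. -/
def IsBoundedExtension (a : H →ₗ.[ℂ] H) (x t : H →L[ℂ] H) : Prop :=
  ∀ ξ : a.domain, ∃ h : x (a ξ) ∈ a†.domain, a† ⟨x (a ξ), h⟩ = t ξ

/-- `∑ i, t i = s` in the weak* topology of `B(H)`, the topology given by the functionals
`x ↦ ∑ k, (x ξ_k, η_k)` with `∑ k, ‖ξ_k‖² < ∞` and `∑ k, ‖η_k‖² < ∞`. -/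
def HasWeakStarSum (t : ℕ → (H →L[ℂ] H)) (s : H →L[ℂ] H) : Prop :=
  ∀ ξ η : ℕ → H, Summable (fun k => ‖ξ k‖ ^ 2) → Summable (fun k => ‖η k‖ ^ 2) →
    HasSum (fun i => ∑' k, inner ℂ (η k) (t i (ξ k))) (∑' k, inner ℂ (η k) (s (ξ k)))

end

open InnerProductSpace Filter
open scoped Topology

section

variable {H : Type*} [NormedAddCommGroup H] [InnerProductSpace ℂ H]

/-! ### Compact operators on a corner -/

/-! Stinespring's construction is carried out on rank one operators only. Write v ⊗ w* for `rankOne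
ℂ v w`. Complete positivity says exactly that the operator valued kernel ((n,v),(m,w)) ↦ Φ(pₙv ⊗
(pₘw)*) is positive semidefinite (`posSemidef_rankOneKernel`), so it has a reproducing kernel
Hilbert space L, which is separable. The kernel functions J(v) : H → L are conjugate linear in v and
satisfy J(v)*J(w) = Φ(v ⊗ w*). For a countable Parseval family (fᵢ) of L, the operators Bᵢ v = J(v)*
fᵢ are linear in v, and Parseval's identity reads Φ(v ⊗ w*) = ∑ᵢ Bᵢ (v ⊗ w*) Bᵢ*
(`exists_rankOne_expansion`). Hence aᵢ = Bᵢ*.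

All levels n share the single space L, so the Bᵢ for different n are compatible and their adjoints
glue to one operator on ⋃ Hₙ. The Bᵢ glue too, which gives a densely defined formal adjoint and so
closability. Bimodularity becomes J(dv) = J(v)d*, so Bᵢ on Hₙ commutes with pₙDpₙ; the identity
(pDp)'p = D'p (`exists_commutant_mul_eq`) then produces the coefficients in D' and the affiliation.

The expansion passes from rank one to compact operators by density: positive maps on C⋆-algebras are
bounded, and ∑ᵢ ‖Bᵢ*ξ‖² ≤ C‖ξ‖² (`exists_sum_norm_adjoint_sq_le`), which also makes the series weak*
convergent. -/

theorem starProjection_eq_sum_rankOne {ι : Type*} [Fintype ι] {U : Submodule ℂ H}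
    [U.HasOrthogonalProjection] (b : OrthonormalBasis ι ℂ U) :
    U.starProjection = ∑ j, rankOne ℂ (b j : H) (b j : H) := by
  ext v
  rw [← U.coe_orthogonalProjectionOnto_apply, ← b.sum_repr' (U.orthogonalProjectionOnto v)]
  simp

/-- The linear span of the rank one operators in the corner given by `p`. -/
def rankOneSpan (p : H →L[ℂ] H) : Submodule ℂ (H →L[ℂ] H) :=
  Submodule.span ℂ (Set.range fun w : H × H => rankOne ℂ (p w.1) (p w.2))

theorem IsCompactOperator.exists_norm_sub_starProjection_mul_le {x : H →L[ℂ] H}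
    (hx : IsCompactOperator x) {ε : ℝ} (hε : 0 < ε) :
    ∃ U : Submodule ℂ H, ∃ _ : FiniteDimensional ℂ U, ‖x - U.starProjection * x‖ ≤ ε := by
  have htb : TotallyBounded (x '' Metric.closedBall 0 1) :=
    (hx.isCompact_closure_image_closedBall 1).totallyBounded.subset subset_closure
  -- The span of a finite ε-net of the image of the unit ball serves as U, since the projection onto
  -- U realises the distance to U.
  obtain ⟨F, hF, hcov⟩ := Metric.totallyBounded_iff.1 htb ε hε
  have : Finite F := hF
  refine ⟨Submodule.span ℂ F, .span_of_finite ℂ hF, ?_⟩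
  have : FiniteDimensional ℂ (Submodule.span ℂ F) := .span_of_finite ℂ hF
  refine ContinuousLinearMap.opNorm_le_of_unit_norm hε.le fun v hv => ?_
  obtain ⟨f, hf, hfv⟩ := Set.mem_iUnion₂.1 (hcov ⟨v, by simp [hv], rfl⟩)
  rw [sub_apply, mul_apply_eq_comp, Submodule.starProjection_minimal]
  refine (ciInf_le ⟨0, ?_⟩ (⟨f, Submodule.subset_span hf⟩ : Submodule.span ℂ F)).trans
    (mem_ball_iff_norm.1 hfv).le
  rintro _ ⟨w, rfl⟩
  exact norm_nonneg _

variable [CompleteSpace H]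

theorem compactCorner_subset_closure_rankOneSpan (p : H →L[ℂ] H) (hp : IsStarProjection p) :
    compactCorner p ⊆ closure (rankOneSpan p : Set (H →L[ℂ] H)) := by
  rintro x ⟨hx, hpx⟩
  have hc : Continuous fun y : H →L[ℂ] H => p * y * p := by fun_prop
  have hps : ContinuousLinearMap.adjoint p = p := hp.isSelfAdjoint
  rw [Metric.mem_closure_iff]
  intro ε hε
  obtain ⟨U, hU, hxU⟩ := hx.exists_norm_sub_starProjection_mul_le (half_pos hε)
  refine ⟨p * (U.starProjection * x) * p, ?_, ?_⟩
  · rw [starProjection_eq_sum_rankOne (stdOrthonormalBasis ℂ U), Finset.sum_mul, Finset.mul_sum,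
      Finset.sum_mul]
    refine Submodule.sum_mem _ fun j _ => Submodule.subset_span
      ⟨(stdOrthonormalBasis ℂ U j, ContinuousLinearMap.adjoint x (stdOrthonormalBasis ℂ U j)), ?_⟩
    ext v
    simp only [mul_apply_eq_comp, rankOne_apply, map_smul]
    rw [← hps, ContinuousLinearMap.adjoint_inner_left, hps, ContinuousLinearMap.adjoint_inner_left]
  · rw [dist_eq_norm]
    nth_rw 1 [← hpx]
    rw [← sub_mul, ← mul_sub]
    have h1 : ‖p‖ ≤ 1 := hp.norm_le
    calc _ ≤ ‖p‖ * ‖x - U.starProjection * x‖ * ‖p‖ := norm_mul₃_le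
      _ ≤ 1 * (ε / 2) * 1 := by gcongr
      _ < ε := by linarith

theorem isClosed_compactCorner (p : H →L[ℂ] H) : IsClosed (compactCorner p) := by
  refine IsClosed.inter (s₁ := {x : H →L[ℂ] H | IsCompactOperator x}) ?_ ?_
  · exact isClosed_setOfPred_isCompactOperator
  · exact isClosed_eq (by fun_prop) continuous_id

theorem rankOne_mem_compactCorner {p : H →L[ℂ] H} (hp : IsStarProjection p) (v w : H) :
    rankOne ℂ (p v) (p w) ∈ compactCorner p := by
  have hps : ContinuousLinearMap.adjoint p = p := hp.isSelfAdjoint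
  have hpp : ∀ v, p (p v) = p v := fun v => by
    rw [← mul_apply_eq_comp, hp.isIdempotentElem.eq]
  refine ⟨?_, ?_⟩
  · exact (isCompactOperator_of_locallyCompactSpace_dom (innerSL ℂ (p w))).clm_comp
      (ContinuousLinearMap.toSpanSingleton ℂ (p v))
  · ext u
    simp only [mul_apply_eq_comp, rankOne_apply, map_smul, hpp]
    rw [← ContinuousLinearMap.adjoint_inner_left, hps, hpp]

/-- The compact operators in the corner given by `p`, as a subspace. -/
def compactCornerSubmodule (p : H →L[ℂ] H) : Submodule ℂ (H →L[ℂ] H) where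
  carrier := compactCorner p
  add_mem' {x y} hx hy := ⟨hx.1.add hy.1, by rw [mul_add, add_mul, hx.2, hy.2]⟩
  zero_mem' := ⟨isCompactOperator_zero, by simp⟩
  smul_mem' c x hx := ⟨hx.1.smul c, by rw [mul_smul_comm, smul_mul_assoc, hx.2]⟩

theorem rankOneSpan_le {p : H →L[ℂ] H} (hp : IsStarProjection p) :
    rankOneSpan p ≤ compactCornerSubmodule p := by
  rw [rankOneSpan, Submodule.span_le]
  rintro _ ⟨w, rfl⟩
  exact rankOne_mem_compactCorner hp _ _

theorem closure_rankOneSpan {p : H →L[ℂ] H} (hp : IsStarProjection p) :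
    closure (rankOneSpan p : Set (H →L[ℂ] H)) = compactCorner p :=
  (closure_minimal (rankOneSpan_le hp) (isClosed_compactCorner p)).antisymm
    (compactCorner_subset_closure_rankOneSpan p hp)

theorem star_mem_rankOneSpan {p x : H →L[ℂ] H} (hx : x ∈ rankOneSpan p) :
    star x ∈ rankOneSpan p := by
  induction hx using Submodule.span_induction with
  | mem x hx =>
    obtain ⟨w, rfl⟩ := hx
    rw [ContinuousLinearMap.star_eq_adjoint, adjoint_rankOne]
    exact Submodule.subset_span ⟨(w.2, w.1), rfl⟩
  | zero => simp
  | add x y _ _ hx hy => rw [star_add]; exact add_mem hx hy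
  | smul c x _ hx => rw [star_smul]; exact Submodule.smul_mem _ _ hx

theorem star_mem_compactCorner {p : H →L[ℂ] H} (hp : IsStarProjection p) {x : H →L[ℂ] H}
    (hx : x ∈ compactCorner p) : star x ∈ compactCorner p := by
  rw [← closure_rankOneSpan hp] at hx ⊢
  exact map_mem_closure continuous_star hx fun _ => star_mem_rankOneSpan

/-- The C⋆-algebra of compact operators in the corner given by a projection. -/
def compactCornerAlgebra {p : H →L[ℂ] H} (hp : IsStarProjection p) :
    NonUnitalStarSubalgebra ℂ (H →L[ℂ] H) where
  __ := compactCornerSubmodule p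
  mul_mem' {x y} hx hy := ⟨hy.1.clm_comp x, by
    rw [← hx.2, ← hy.2]
    simp only [mul_assoc, hp.isIdempotentElem.mul_self_mul, hp.isIdempotentElem.eq]⟩
  star_mem' := star_mem_compactCorner hp

instance {p : H →L[ℂ] H} {hp : IsStarProjection p} :
    IsClosed (compactCornerAlgebra hp : Set (H →L[ℂ] H)) :=
  isClosed_compactCorner p

end

section

variable {H : Type*} [NormedAddCommGroup H] [InnerProductSpace ℂ H] [CompleteSpace H]

theorem IsStarProjection.adjoint_eq {p : H →L[ℂ] H} (hp : IsStarProjection p) :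
    ContinuousLinearMap.adjoint p = p :=
  hp.isSelfAdjoint

theorem IsStarProjection.apply_apply {p : H →L[ℂ] H} (hp : IsStarProjection p) (v : H) :
    p (p v) = p v := by
  rw [← mul_apply_eq_comp, hp.isIdempotentElem.eq]

theorem IsStarProjection.inner_apply {p : H →L[ℂ] H} (hp : IsStarProjection p) (v w : H) :
    inner ℂ v (p w) = inner ℂ (p v) w := by
  rw [← ContinuousLinearMap.adjoint_inner_left, hp.adjoint_eq]

theorem IsStarProjection.exists_norm_eq_one {p : H →L[ℂ] H} (hp : IsStarProjection p)
    (h0 : p ≠ 0) : ∃ e, p e = e ∧ ‖e‖ = 1 := by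
  obtain ⟨v, hv⟩ : ∃ v, p v ≠ 0 := by
    by_contra! h
    exact h0 (ContinuousLinearMap.ext h)
  refine ⟨((‖p v‖⁻¹ : ℝ) : ℂ) • p v, by rw [map_smul, hp.apply_apply], ?_⟩
  rw [norm_smul]
  simp [hv]

/-! ### Completely positive maps on the compact operators of a corner -/

namespace IsCompletelyPositiveOn

variable {Φ : (H →L[ℂ] H) → (H →L[ℂ] H)} {p : H →L[ℂ] H}

/-- A completely positive map on the compact operators of a corner, as a linear map. -/
def toLinearMap (h : IsCompletelyPositiveOn Φ p) (hp : IsStarProjection p) :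
    compactCornerAlgebra hp →ₗ[ℂ] (H →L[ℂ] H) where
  toFun x := Φ x
  map_add' x y := h.map_add x x.2 y y.2
  map_smul' c x := h.map_smul c x x.2

theorem map_zero (h : IsCompletelyPositiveOn Φ p) (hp : IsStarProjection p) : Φ 0 = 0 :=
  _root_.map_zero (h.toLinearMap hp)

theorem map_eq (h : IsCompletelyPositiveOn Φ p) {x : H →L[ℂ] H} (hx : x ∈ compactCorner p) :
    p * Φ x * p = Φ x :=
  h.mapsTo hx

theorem inner_map (h : IsCompletelyPositiveOn Φ p) (hp : IsStarProjection p) {x : H →L[ℂ] H}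
    (hx : x ∈ compactCorner p) (ξ η : H) :
    inner ℂ ξ (Φ x η) = inner ℂ (p ξ) (Φ x (p η)) := by
  rw [← h.map_eq hx]
  simp only [mul_apply_eq_comp, hp.apply_apply, hp.inner_apply]

theorem sum_inner_nonneg (h : IsCompletelyPositiveOn Φ p) (hp : IsStarProjection p) {m : ℕ}
    (a : Fin m → (H →L[ℂ] H)) (ξ : Fin m → H) (ha : ∀ k, a k ∈ compactCorner p) :
    0 ≤ ∑ k, ∑ l, inner ℂ (ξ k) (Φ (star (a k) * a l) (ξ l)) := by
  refine (h.nonneg m a (fun k => p (ξ k)) ha fun k => hp.apply_apply _).trans_eq ?_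
  refine Finset.sum_congr rfl fun k _ => Finset.sum_congr rfl fun l _ => ?_
  rw [← h.inner_map hp]
  exact mul_mem (S := NonUnitalStarSubalgebra ℂ (H →L[ℂ] H)) (s := compactCornerAlgebra hp)
    (star_mem_compactCorner hp (ha k)) (ha l)

theorem map_star_mul_self_nonneg (h : IsCompletelyPositiveOn Φ p) (hp : IsStarProjection p)
    {x : H →L[ℂ] H} (hx : x ∈ compactCorner p) : 0 ≤ Φ (star x * x) := by
  rw [ContinuousLinearMap.nonneg_iff_isPositive, ContinuousLinearMap.isPositive_iff_complex]
  intro ξ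
  have := h.sum_inner_nonneg hp (m := 1) (fun _ => x) (fun _ => ξ) fun _ => hx
  simp only [Finset.univ_unique, Finset.sum_const, Finset.card_singleton, one_smul] at this
  have hn : 0 ≤ inner ℂ (Φ (star x * x) ξ) ξ := by
    rw [← inner_conj_symm]
    exact star_nonneg_iff.2 this
  obtain ⟨h1, h2⟩ := Complex.nonneg_iff.1 hn
  exact ⟨Complex.ext (by simp) (by simpa using h2), h1⟩

theorem exists_positiveLinearMap (h : IsCompletelyPositiveOn Φ p) (hp : IsStarProjection p)
    [PartialOrder (compactCornerAlgebra hp)] [StarOrderedRing (compactCornerAlgebra hp)] :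
    ∃ f : compactCornerAlgebra hp →ₚ[ℂ] (H →L[ℂ] H), ∀ x, f x = Φ x :=
  ⟨PositiveLinearMap.mk₀ (h.toLinearMap hp) fun x hx => by
    obtain ⟨y, rfl⟩ := CStarAlgebra.nonneg_iff_eq_star_mul_self.1 hx
    exact h.map_star_mul_self_nonneg hp y.2, fun _ => rfl⟩

/-- Automatic continuity: the compact operators of the corner form a C⋆-algebra, and positivity
alone forces boundedness. -/
theorem exists_norm_map_le (h : IsCompletelyPositiveOn Φ p) (hp : IsStarProjection p) :
    ∃ C : ℝ, 0 ≤ C ∧ ∀ x ∈ compactCorner p, ‖Φ x‖ ≤ C * ‖x‖ := by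
  let _ := CStarAlgebra.spectralOrder (compactCornerAlgebra hp)
  have _ := CStarAlgebra.spectralOrderedRing (compactCornerAlgebra hp)
  obtain ⟨f, hf⟩ := h.exists_positiveLinearMap hp
  obtain ⟨C, hC⟩ := f.exists_norm_apply_le
  exact ⟨C, C.2, fun x hx => by simpa [hf] using! hC ⟨x, hx⟩⟩

theorem map_star (h : IsCompletelyPositiveOn Φ p) (hp : IsStarProjection p) {x : H →L[ℂ] H}
    (hx : x ∈ compactCorner p) : Φ (star x) = star (Φ x) := by
  let _ := CStarAlgebra.spectralOrder (compactCornerAlgebra hp)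
  have _ := CStarAlgebra.spectralOrderedRing (compactCornerAlgebra hp)
  obtain ⟨f, hf⟩ := h.exists_positiveLinearMap hp
  have := StarHomClass.map_star f ⟨x, hx⟩
  rwa [hf, hf] at this

/-- For a unit vector e in pH, the operators aₖ = e ⊗ (pωₖ)* satisfy aₖ*aₗ = pωₖ ⊗ (pωₗ)*. -/
theorem sum_inner_map_rankOne_nonneg (h : IsCompletelyPositiveOn Φ p) (hp : IsStarProjection p)
    {ι : Type*} (s : Finset ι) (ω ξ : ι → H) :
    0 ≤ ∑ k ∈ s, ∑ l ∈ s, inner ℂ (ξ k) (Φ (rankOne ℂ (p (ω k)) (p (ω l))) (ξ l)) := by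
  by_cases h0 : p = 0
  · simp [h0, h.map_zero hp]
  obtain ⟨e, hpe, he⟩ := hp.exists_norm_eq_one h0
  let g := s.equivFin.symm
  have := h.sum_inner_nonneg hp (fun k => rankOne ℂ e (p (ω (g k)))) (fun k => ξ (g k)) fun k => by
    rw [← hpe]
    exact rankOne_mem_compactCorner hp _ _
  simp only [ContinuousLinearMap.star_eq_adjoint, adjoint_rankOne, ContinuousLinearMap.mul_def,
    rankOne_comp_rankOne, inner_self_eq_norm_sq_to_K, he] at this
  simp only [Complex.coe_algebraMap, Complex.ofReal_one, one_pow, one_smul] at this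
  rw [← Finset.sum_coe_sort, ← Equiv.sum_comp g]
  refine this.trans_eq (Finset.sum_congr rfl fun k _ => ?_)
  exact (Equiv.sum_comp g fun l : s => _).trans
    (Finset.sum_coe_sort s fun l => inner ℂ (ξ (g k)) (Φ (rankOne ℂ (p (ω (g k))) (p (ω l))) (ξ l)))

end IsCompletelyPositiveOn

end

section

variable {H : Type*} [NormedAddCommGroup H] [InnerProductSpace ℂ H] [CompleteSpace H]

/-! ### The commutant of a compressed algebra -/

theorem star_compressedAlgebra (D : StarSubalgebra ℂ (H →L[ℂ] H)) {p : H →L[ℂ] H}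
    (hp : IsStarProjection p) :
    star (compressedAlgebra D p) = compressedAlgebra D p := by
  have h : ∀ y ∈ compressedAlgebra D p, star y ∈ compressedAlgebra D p := by
    rintro _ ⟨d, hd, rfl⟩
    refine ⟨star d, star_mem hd, ?_⟩
    simp only [star_mul, hp.isSelfAdjoint.star_eq, mul_assoc]
  ext y
  exact ⟨fun hy => by simpa using h _ hy, fun hy => h _ hy⟩

theorem inner_apply_apply_of_unitary {D : StarSubalgebra ℂ (H →L[ℂ] H)} {p u : H →L[ℂ] H}
    (hp : IsStarProjection p) (hu : u ∈ unitary (H →L[ℂ] H))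
    (hc : u ∈ Set.centralizer (compressedAlgebra D p)) {d d' : H →L[ℂ] H} (hd : d ∈ D)
    (hd' : d' ∈ D) (x y : H) :
    inner ℂ (d (p (u x))) (d' (p (u y))) = inner ℂ (d (p x)) (d' (p y)) := by
  have h : ∀ v w, inner ℂ (d (p v)) (d' (p w)) = inner ℂ v ((p * (star d * d') * p) w) := by
    intro v w
    simp only [mul_apply_eq_comp, hp.inner_apply, ContinuousLinearMap.star_eq_adjoint,
      ContinuousLinearMap.adjoint_inner_right]
  have huu : star u * u = 1 := Unitary.star_mul_self_of_mem hu
  rw [h, h, ← mul_apply_eq_comp, hc _ ⟨star d * d', mul_mem (star_mem hd) hd', rfl⟩,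
    mul_apply_eq_comp, ← ContinuousLinearMap.adjoint_inner_right,
    ← ContinuousLinearMap.star_eq_adjoint, ← mul_apply_eq_comp, huu, one_apply_eq_self]

/-- Since u commutes with p d*d' p, the map d p ξ ↦ d p u ξ is isometric on the closed span K of D p
H. Both K and Kᗮ are D-invariant, so extending it by zero on Kᗮ gives an element of D'. -/
theorem exists_commutant_mul_eq_of_unitary {D : StarSubalgebra ℂ (H →L[ℂ] H)} {p u : H →L[ℂ] H}
    (hp : IsStarProjection p) (hu : u ∈ unitary (H →L[ℂ] H))
    (hc : u ∈ Set.centralizer (compressedAlgebra D p)) :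
    ∃ c ∈ commutantVN D, c * p = u * p := by
  -- Formal sums ∑ d ⊗ ξ parametrise the span of D p H; equality of the norms of `e g` and `f g`
  -- makes e g ↦ f g well defined.
  let e : (D →₀ H) →ₗ[ℂ] H := Finsupp.lsum ℂ fun d : D => ((d : H →L[ℂ] H) * p : H →ₗ[ℂ] H)
  let f : (D →₀ H) →ₗ[ℂ] H := Finsupp.lsum ℂ fun d : D => ((d : H →L[ℂ] H) * p * u : H →ₗ[ℂ] H)
  have hnorm : ∀ g, ‖f g‖ ≤ 1 * ‖e g‖ := by
    intro g
    rw [one_mul]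
    refine le_of_eq ?_
    have : inner ℂ (f g) (f g) = inner ℂ (e g) (e g) := by
      simp only [e, f, Finsupp.lsum_apply, Finsupp.sum, sum_inner, inner_sum]
      refine Finset.sum_congr rfl fun d _ => Finset.sum_congr rfl fun d' _ => ?_
      exact inner_apply_apply_of_unitary hp hu hc d'.2 d.2 _ _
    rw [@norm_eq_sqrt_re_inner ℂ, this, ← @norm_eq_sqrt_re_inner ℂ]
  let K : Submodule ℂ H := (LinearMap.range e).topologicalClosure
  have heK : ∀ g, e g ∈ K := fun g => Submodule.le_topologicalClosure _ ⟨g, rfl⟩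
  have : CompleteSpace K := (Submodule.isClosed_topologicalClosure _).completeSpace_coe
  let e' : (D →₀ H) →ₗ[ℂ] K := e.codRestrict K heK
  have hdense : DenseRange e' := by
    rw [DenseRange, Subtype.dense_iff, ← Set.range_comp]
    exact fun v hv => hv
  let c : H →L[ℂ] H := (f.extendOfNorm e').comp K.orthogonalProjectionOnto
  have hce : ∀ g, c (e g) = f g := by
    intro g
    have h1 : K.orthogonalProjectionOnto (e g) = e' g :=
      K.orthogonalProjectionOnto_mem_subspace_eq_self (e' g)
    simp only [c, ContinuousLinearMap.comp_apply, h1]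
    exact LinearMap.extendOfNorm_eq hdense ⟨1, hnorm⟩ g
  have hc1 : ∀ d ∈ D, ∀ ξ, c (d (p ξ)) = d (p (u ξ)) := by
    intro d hd ξ
    have := hce (Finsupp.single ⟨d, hd⟩ ξ)
    simpa [e, f] using this
  have hc0 : ∀ v ∈ Kᗮ, c v = 0 := by
    intro v hv
    simp [c, Submodule.orthogonalProjectionOnto_apply_of_mem_orthogonal hv]
  have hspan : ∀ q : Submodule ℂ H, (∀ d ∈ D, ∀ ξ, d (p ξ) ∈ q) → LinearMap.range e ≤ q := by
    rintro q hq _ ⟨g, rfl⟩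
    exact Submodule.sum_mem _ fun d _ => hq d d.2 _
  have horth : ∀ v, v ∈ Kᗮ ↔ ∀ d ∈ D, ∀ ξ, inner ℂ (d (p ξ)) v = 0 := by
    intro v
    rw [Submodule.orthogonal_closure]
    constructor
    · intro hv d hd ξ
      refine hv _ ⟨Finsupp.single ⟨d, hd⟩ ξ, ?_⟩
      simp [e]
    · intro hv
      have := hspan ((ℂ ∙ v)ᗮ) fun d hd ξ =>
        Submodule.mem_orthogonal_singleton_iff_inner_left.2 (hv d hd ξ)
      intro w hw
      exact Submodule.mem_orthogonal_singleton_iff_inner_left.1 (this hw)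
  refine ⟨c, mem_commutantVN_iff.2 fun d hd => ?_, ?_⟩
  · have hle : K ⊔ Kᗮ ≤ LinearMap.eqLocus
        ((d * c : H →L[ℂ] H) : H →ₗ[ℂ] H) ((c * d : H →L[ℂ] H) : H →ₗ[ℂ] H) := by
      refine sup_le ?_ ?_
      · refine Submodule.topologicalClosure_minimal _ (hspan _ fun d' hd' ξ => ?_) ?_
        · have := hc1 (d * d') (mul_mem hd hd') ξ
          simpa [hc1 d' hd'] using this.symm
        · exact isClosed_eq (d * c).continuous (c * d).continuous
      · intro v hv
        have hdv : d v ∈ Kᗮ := (horth _).2 fun d' hd' ξ => by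
          rw [← ContinuousLinearMap.adjoint_inner_left]
          exact (horth v).1 hv _ (mul_mem (star_mem hd) hd') ξ
        simp [hc0 v hv, hc0 _ hdv]
    rw [Submodule.sup_orthogonal_of_hasOrthogonalProjection] at hle
    exact ContinuousLinearMap.ext fun v => hle (Submodule.mem_top (x := v))
  · have hpu : p * u = u * p := by
      simpa [hp.isIdempotentElem.eq] using hc (p * 1 * p) ⟨1, one_mem _, rfl⟩
    rw [← hpu]
    exact ContinuousLinearMap.ext fun ξ => hc1 1 (one_mem _) ξ

/-- The commutant of the self-adjoint set pDp is a unital C⋆-algebra, hence the span of its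
unitaries, and the claim is linear in A. -/
theorem exists_commutant_mul_eq {D : StarSubalgebra ℂ (H →L[ℂ] H)} {p A : H →L[ℂ] H}
    (hp : IsStarProjection p)
    (hc : A ∈ Set.centralizer (compressedAlgebra D p)) :
    ∃ c ∈ commutantVN D, c * p = A * p := by
  let E : StarSubalgebra ℂ (H →L[ℂ] H) := StarSubalgebra.centralizer ℂ (compressedAlgebra D p)
  have hEm : ∀ {x}, x ∈ E ↔ x ∈ Set.centralizer (compressedAlgebra D p) := by
    intro x
    have : (E : Set (H →L[ℂ] H)) = Set.centralizer
        (compressedAlgebra D p ∪ star (compressedAlgebra D p)) := rfl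
    rw [← SetLike.mem_coe, this, star_compressedAlgebra D hp, Set.union_self]
  have hE : IsClosed (E : Set (H →L[ℂ] H)) := Set.isClosed_centralizer _
  have hspan := CStarAlgebra.span_unitary E
  have hA : (⟨A, hEm.2 hc⟩ : E) ∈ Submodule.span ℂ (unitary E : Set E) := by
    rw [hspan]; exact Submodule.mem_top
  have key : ∀ x ∈ Submodule.span ℂ (unitary E : Set E),
      ∃ c ∈ commutantVN D, c * p = (x : H →L[ℂ] H) * p := by
    intro x hx
    induction hx using Submodule.span_induction with
    | mem u hu =>
      refine exists_commutant_mul_eq_of_unitary hp ?_ (hEm.1 u.2)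
      exact ⟨congrArg Subtype.val hu.1, congrArg Subtype.val hu.2⟩
    | zero => exact ⟨0, zero_mem _, by simp⟩
    | add x y _ _ hx hy =>
      obtain ⟨c, hc, hcx⟩ := hx
      obtain ⟨c', hc', hcy⟩ := hy
      exact ⟨c + c', add_mem hc hc', by simp [add_mul, hcx, hcy]⟩
    | smul r x _ hx =>
      obtain ⟨c, hc, hcx⟩ := hx
      exact ⟨r • c, (commutantVN D).toStarSubalgebra.smul_mem hc r, by simp [hcx]⟩
  exact key _ hA

end

section

/-! ### Countable Parseval families -/

theorem Orthonormal.countable_of_separable {L : Type*} [NormedAddCommGroup L]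
    [InnerProductSpace ℂ L] [TopologicalSpace.SeparableSpace L] {ι : Type*} {v : ι → L}
    (hv : Orthonormal ℂ v) : Countable ι := by
  refine Pairwise.countable_of_isOpen_disjoint (s := fun i => Metric.ball (v i) (1 / 2)) ?_
    (fun i => Metric.isOpen_ball) fun i => ⟨v i, by simp⟩
  intro i j hij
  refine Metric.ball_disjoint_ball ?_
  have h : ‖v i - v j‖ ^ 2 = 2 := by
    rw [@norm_sub_sq ℂ, hv.1 i, hv.1 j, hv.2 hij]
    norm_num
  rw [dist_eq_norm]
  nlinarith [norm_nonneg (v i - v j)]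

theorem exists_parseval_family (L : Type*) [NormedAddCommGroup L] [InnerProductSpace ℂ L]
    [CompleteSpace L] [TopologicalSpace.SeparableSpace L] :
    ∃ f : ℕ → L, ∀ x y, HasSum (fun i => inner ℂ x (f i) * inner ℂ (f i) y) (inner ℂ x y) := by
  obtain ⟨w, b, -⟩ := exists_hilbertBasis ℂ L
  have := b.orthonormal.countable_of_separable
  obtain ⟨g, hg⟩ := exists_injective_nat w
  -- Padding an orthonormal basis with zeros gives indexing by ℕ even when L is finite dimensional.
  refine ⟨Function.extend g b 0, fun x y => ?_⟩
  rw [← hg.hasSum_iff fun n hn => ?_]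
  · simpa [Function.comp_def, hg.extend_apply] using b.hasSum_inner_mul_inner x y
  · rw [Function.extend_apply' _ _ _ hn]
    simp

end

section

variable {H : Type*} [NormedAddCommGroup H] [InnerProductSpace ℂ H] [CompleteSpace H]

/-! ### Increasing sequences of projections -/

section Projections

variable {p : ℕ → (H →L[ℂ] H)} (hp : ∀ n, IsStarProjection (p n)) (hmono : Monotone p)
include hp hmono

theorem mul_eq_left_of_monotone {n m : ℕ} (h : n ≤ m) : p n * p m = p n :=
  ((hp n).le_iff_mul_eq_left (hp m)).1 (hmono h)

theorem mul_eq_right_of_monotone {n m : ℕ} (h : n ≤ m) : p m * p n = p n :=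
  ((hp n).le_iff_mul_eq_right (hp m)).1 (hmono h)

theorem apply_apply_of_le {n m : ℕ} (h : n ≤ m) (v : H) : p m (p n v) = p n v := by
  rw [← mul_apply_eq_comp, mul_eq_right_of_monotone hp hmono h]

theorem tendsto_projection
    (hsup : (⨆ n, LinearMap.range (p n : H →ₗ[ℂ] H)).topologicalClosure = ⊤) (v : H) :
    Tendsto (fun n => p n v) atTop (𝓝 v) := by
  choose hU hpU using fun n => isStarProjection_iff_eq_starProjection_range.1 (hp n)
  have := Submodule.starProjection_tendsto_self (fun n => LinearMap.range (p n : H →ₗ[ℂ] H))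
    (fun n m h => ?_) v hsup.ge
  · exact this.congr fun n => (DFunLike.congr_fun (hpU n) v).symm
  · rintro _ ⟨w, rfl⟩
    exact ⟨p n w, apply_apply_of_le hp hmono h w⟩

theorem rankOne_mem_compactCorner_of_le {n m N : ℕ} (hn : n ≤ N) (hm : m ≤ N) (v w : H) :
    rankOne ℂ (p n v) (p m w) ∈ compactCorner (p N) := by
  rw [← apply_apply_of_le hp hmono hn, ← apply_apply_of_le hp hmono hm]
  exact rankOne_mem_compactCorner (hp N) _ _

end Projections

/-! ### The operator valued kernel of a completely positive map -/

section Kernel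

variable {p : ℕ → (H →L[ℂ] H)} {Φ : (H →L[ℂ] H) → (H →L[ℂ] H)}

/-- The operator valued kernel given by the values of `Φ` on rank one operators. -/
noncomputable def rankOneKernel (p : ℕ → (H →L[ℂ] H)) (Φ : (H →L[ℂ] H) → (H →L[ℂ] H)) :
    Matrix (ℕ × H) (ℕ × H) (H →L[ℂ] H) :=
  .of fun x y => Φ (rankOne ℂ (p x.1 x.2) (p y.1 y.2))

omit [CompleteSpace H] in
theorem rankOneKernel_apply (x y : ℕ × H) :
    rankOneKernel p Φ x y = Φ (rankOne ℂ (p x.1 x.2) (p y.1 y.2)) :=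
  rfl

variable (hp : ∀ n, IsStarProjection (p n)) (hmono : Monotone p)
  (hcp : ∀ n, IsCompletelyPositiveOn Φ (p n))
include hp hmono hcp

theorem star_rankOneKernel (x y : ℕ × H) :
    star (rankOneKernel p Φ x y) = rankOneKernel p Φ y x := by
  rw [rankOneKernel_apply, ← (hcp (max x.1 y.1)).map_star (hp _)
    (rankOne_mem_compactCorner_of_le hp hmono (le_max_left _ _) (le_max_right _ _) _ _),
    ContinuousLinearMap.star_eq_adjoint, adjoint_rankOne]
  rfl

theorem inner_rankOneKernel (x y : ℕ × H) (ξ η : H) :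
    inner ℂ (rankOneKernel p Φ x y ξ) η = inner ℂ ξ (rankOneKernel p Φ y x η) := by
  rw [← star_rankOneKernel hp hmono hcp x y, ContinuousLinearMap.star_eq_adjoint,
    ContinuousLinearMap.adjoint_inner_right]

/-- A finitely supported family involves finitely many levels, so a single N dominates them all and
complete positivity on K(H_N) applies. -/
theorem posSemidef_rankOneKernel : (rankOneKernel p Φ).PosSemidef := by
  have htfae := (RKHS.posSemidef_tfae (K := rankOneKernel p Φ)).out 0 2
  refine htfae.mpr (And.intro ?_ fun vv => ?_)
  · exact Matrix.ext fun x y => star_rankOneKernel hp hmono hcp y x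
  · obtain ⟨N, hN⟩ := (vv.support.image Prod.fst).exists_le
    have h := (hcp N).sum_inner_map_rankOne_nonneg (hp N) vv.support (fun x => p x.1 x.2) vv
    refine (RCLike.nonneg_iff.1 h).1.trans_eq (congrArg _ ?_)
    refine Finset.sum_congr rfl fun x hx => Finset.sum_congr rfl fun y hy => ?_
    rw [apply_apply_of_le hp hmono (hN _ (Finset.mem_image_of_mem _ hx)),
      apply_apply_of_le hp hmono (hN _ (Finset.mem_image_of_mem _ hy))]
    exact (inner_rankOneKernel hp hmono hcp _ _ _ _).symm

end Kernel

end

/-! ### Bimodularity of the kernel and the Kraus family -/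

section

universe u

variable {H : Type u} [NormedAddCommGroup H] [InnerProductSpace ℂ H] [CompleteSpace H]
variable {p : ℕ → (H →L[ℂ] H)} {Φ : (H →L[ℂ] H) → (H →L[ℂ] H)}
  (hp : ∀ n, IsStarProjection (p n)) (hmono : Monotone p)
  (hcp : ∀ n, IsCompletelyPositiveOn Φ (p n))
include hp hmono hcp

theorem rankOneKernel_add (x : ℕ × H) (n : ℕ) (v w : H) :
    rankOneKernel p Φ x (n, v + w) = rankOneKernel p Φ x (n, v) + rankOneKernel p Φ x (n, w) := by
  have h := fun v => rankOne_mem_compactCorner_of_le hp hmono (le_max_left x.1 n)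
    (le_max_right _ _) x.2 v
  simp only [rankOneKernel_apply, map_add]
  exact (hcp _).map_add _ (h v) _ (h w)

theorem rankOneKernel_smul (x : ℕ × H) (n : ℕ) (c : ℂ) (v : H) :
    rankOneKernel p Φ x (n, c • v) = star c • rankOneKernel p Φ x (n, v) := by
  have h := rankOne_mem_compactCorner_of_le hp hmono (le_max_left x.1 n) (le_max_right _ _) x.2 v
  simp only [rankOneKernel_apply, map_smul, map_smulₛₗ]
  exact (hcp _).map_smul _ _ h

omit hcp in
theorem rankOneKernel_apply_of_le (x : ℕ × H) {n m : ℕ} (h : n ≤ m) (v : H) :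
    rankOneKernel p Φ x (m, p n v) = rankOneKernel p Φ x (n, v) := by
  simp only [rankOneKernel_apply, apply_apply_of_le hp hmono h]

/-- Because v ⊗ (dw)* = (v ⊗ w*)d*, this is right modularity of Φ, applied at a level N above both
indices with p_N as the trivial left factor. -/
theorem rankOneKernel_apply_compressed {D : StarSubalgebra ℂ (H →L[ℂ] H)} (hpD : ∀ n, p n ∈ D)
    (hbimod : ∀ n, IsBimodularOn Φ (compressedAlgebra D (p n)) (compactCorner (p n)))
    (x : ℕ × H) (n : ℕ) {d : H →L[ℂ] H} (hd : d ∈ compressedAlgebra D (p n)) (v : H) :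
    rankOneKernel p Φ x (n, d v) = rankOneKernel p Φ x (n, v) * star d := by
  obtain ⟨d, hdD, rfl⟩ := hd
  set N := max x.1 n
  have hx : x.1 ≤ N := le_max_left _ _
  have hn : n ≤ N := le_max_right _ _
  have hr := rankOne_mem_compactCorner_of_le hp hmono hx hn x.2 v
  have hb := hbimod N (p N) ⟨1, one_mem _, by simp [(hp N).isIdempotentElem.eq]⟩
    (star (p n * d * p n)) ⟨star (p n * d * p n),
      star_mem (mul_mem (mul_mem (hpD n) hdD) (hpD n)), ?_⟩ _ hr
  · have hstar : star (p n * d * p n) = p n * star d * p n := by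
      simp only [star_mul, (hp n).isSelfAdjoint.star_eq, mul_assoc]
    have h1 : p N * rankOne ℂ (p x.1 x.2) (p n v) * star (p n * d * p n) =
        rankOne ℂ (p x.1 x.2) (p n ((p n * d * p n) v)) := by
      ext w
      simp only [mul_apply_eq_comp, rankOne_apply, map_smul, apply_apply_of_le hp hmono hx,
        hstar, (hp n).inner_apply, (hp n).apply_apply, ContinuousLinearMap.star_eq_adjoint,
        ContinuousLinearMap.adjoint_inner_right]
    rw [h1] at hb
    rw [rankOneKernel_apply, rankOneKernel_apply, hb, ← (hcp N).map_eq hr]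
    have h2 : p N * (p N * Φ (rankOne ℂ (p x.1 x.2) (p n v)) * p N) =
        p N * Φ (rankOne ℂ (p x.1 x.2) (p n v)) * p N := by
      rw [← mul_assoc, ← mul_assoc, (hp N).isIdempotentElem.eq]
    rw [h2]
  · simp only [star_mul, (hp n).isSelfAdjoint.star_eq]
    simp only [← mul_assoc, mul_eq_right_of_monotone hp hmono hn]
    simp only [mul_assoc, mul_eq_left_of_monotone hp hmono hn]

omit hp hmono hcp in
/-- If the kernel is conjugate linear and bounded in the vector variable, the kernel functions
assemble to a bounded map, conjugate linear in that variable. -/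
theorem RKHS.exists_kernelMap {L : Type*} [NormedAddCommGroup L] [InnerProductSpace ℂ L]
    [CompleteSpace L] [RKHS ℂ L (ℕ × H) H] (n : ℕ)
    (hadd : ∀ x v w, RKHS.kernel L x (n, v + w) = RKHS.kernel L x (n, v) + RKHS.kernel L x (n, w))
    (hsmul : ∀ x (c : ℂ) v, RKHS.kernel L x (n, c • v) = star c • RKHS.kernel L x (n, v))
    (hbound : ∃ C, 0 ≤ C ∧ ∀ v, ‖RKHS.kernel L (n, v) (n, v)‖ ≤ C * ‖v‖ ^ 2) :
    ∃ J : H →L⋆[ℂ] H →L[ℂ] L, ∀ v, J v = RKHS.kerFun L (n, v) := by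
  obtain ⟨C, hC, hbound⟩ := hbound
  refine ⟨LinearMap.mkContinuous
    { toFun := fun v => RKHS.kerFun L (n, v)
      map_add' := fun v w => ?_
      map_smul' := fun c v => ?_ } (√C) fun v => ?_, fun v => rfl⟩
  · ext ξ x
    simp [RKHS.kerFun_apply, hadd]
  · ext ξ x
    simp [RKHS.kerFun_apply, hsmul]
  · change ‖RKHS.kerFun L (n, v)‖ ≤ _
    rw [RKHS.norm_kerFun_eq_sqrt_norm_kernel]
    refine (Real.sqrt_le_sqrt (hbound v)).trans_eq ?_
    rw [Real.sqrt_mul hC, Real.sqrt_sq (norm_nonneg v)]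

theorem exists_kernel_space [TopologicalSpace.SeparableSpace H] :
    ∃ (L : Type u) (_ : NormedAddCommGroup L) (_ : InnerProductSpace ℂ L) (_ : CompleteSpace L)
      (_ : TopologicalSpace.SeparableSpace L) (_ : RKHS ℂ L (ℕ × H) H)
      (J : ℕ → H →L⋆[ℂ] H →L[ℂ] L),
      RKHS.kernel L = rankOneKernel p Φ ∧ ∀ n v, J n v = RKHS.kerFun L (n, v) := by
  have : Fact (rankOneKernel p Φ).PosSemidef := ⟨posSemidef_rankOneKernel hp hmono hcp⟩
  let L := RKHS.OfKernel (rankOneKernel p Φ)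
  have hk : RKHS.kernel L = rankOneKernel p Φ := RKHS.OfKernel.kernel_ofKernel
  choose J hJ using fun n => RKHS.exists_kernelMap (L := L) n
    (fun x v w => by simp only [hk]; exact rankOneKernel_add hp hmono hcp x n v w)
    (fun x c v => by simp only [hk]; exact rankOneKernel_smul hp hmono hcp x n c v)
    (by
      obtain ⟨C, hC, h⟩ := (hcp n).exists_norm_map_le (hp n)
      refine ⟨C, hC, fun v => ?_⟩
      rw [hk, rankOneKernel_apply]
      refine (h _ (rankOne_mem_compactCorner (hp n) v v)).trans ?_
      have hv : ‖p n v‖ ≤ ‖v‖ := ((p n).le_of_opNorm_le (hp n).norm_le v).trans_eq (one_mul _)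
      rw [norm_rankOne, sq]
      gcongr)
  have hsep : TopologicalSpace.SeparableSpace L := by
    -- The kernel functions span a dense subspace, and they form a countable union of continuous
    -- images of H × H.
    rw [← TopologicalSpace.isSeparable_univ_iff]
    have h : TopologicalSpace.IsSeparable (⋃ n, Set.range fun w : H × H => J n w.1 w.2) :=
      .iUnion fun n => TopologicalSpace.isSeparable_range (by fun_prop)
    have := (h.span (R := ℂ)).closure
    refine this.mono fun x _ => ?_
    have hx : x ∈ (Submodule.span ℂ {RKHS.kerFun L x v | (x) (v)}).topologicalClosure := by
      rw [RKHS.kerFun_dense]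
      exact Submodule.mem_top
    refine closure_mono (Submodule.span_mono ?_) hx
    rintro _ ⟨x, v, rfl⟩
    exact Set.mem_iUnion.2 ⟨x.1, (x.2, v), by simp [hJ]⟩
  exact ⟨L, inferInstance, inferInstance, inferInstance, hsep, inferInstance, J, hk, hJ⟩

/-- The Kraus family of a completely positive bimodule map, in terms of the adjoints of the
coefficients. -/
theorem exists_rankOne_expansion [TopologicalSpace.SeparableSpace H]
    {D : StarSubalgebra ℂ (H →L[ℂ] H)} (hpD : ∀ n, p n ∈ D)
    (hbimod : ∀ n, IsBimodularOn Φ (compressedAlgebra D (p n)) (compactCorner (p n))) :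
    ∃ B : ℕ → ℕ → (H →L[ℂ] H),
      (∀ n v w ξ η, HasSum (fun i => inner ℂ ξ (B i n v) * inner ℂ (B i n w) η)
        (inner ℂ ξ (Φ (rankOne ℂ (p n v) (p n w)) η))) ∧
      (∀ i n m, n ≤ m → B i m * p n = B i n) ∧
      (∀ i n, B i n ∈ Set.centralizer (compressedAlgebra D (p n))) := by
  obtain ⟨L, _, _, _, _, _, J, hk, hJ⟩ := exists_kernel_space hp hmono hcp
  obtain ⟨f, hf⟩ := exists_parseval_family L
  have hJJ : ∀ n v w ξ η, inner ℂ (J n v ξ) (J n w η) =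
      inner ℂ ξ (rankOneKernel p Φ (n, v) (n, w) η) := by
    intro n v w ξ η
    rw [hJ, hJ, ← RKHS.kernel_inner, hk, inner_rankOneKernel hp hmono hcp]
  -- Both `J n` and the adjoint are conjugate linear, so v ↦ (J n v)* g is linear.
  have hker : ∀ (n : ℕ) (g : L), ∃ T : H →L[ℂ] H,
      ∀ v, T v = ContinuousLinearMap.adjoint (J n v) g := fun n g =>
    ⟨(ContinuousLinearMap.apply ℂ H g).comp
      ((ContinuousLinearMap.adjoint :
        (H →L[ℂ] L) ≃ₗᵢ⋆[ℂ] _).toContinuousLinearEquiv.toContinuousLinearMap.comp (J n)),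
      fun v => rfl⟩
  choose B hB using hker
  have hcongr : ∀ {n m v w} (S : H →L[ℂ] H),
      (∀ x, rankOneKernel p Φ x (n, v) = rankOneKernel p Φ x (m, w) * S) →
      J n v = (J m w).comp S := by
    intro n m v w S h
    ext ξ x
    simp [hJ, RKHS.kerFun_apply, hk, h]
  refine ⟨fun i n => B n (f i), ?_, ?_, ?_⟩
  · intro n v w ξ η
    have := hf (J n v ξ) (J n w η)
    rw [hJJ] at this
    simpa only [hB, ContinuousLinearMap.adjoint_inner_right,
      ContinuousLinearMap.adjoint_inner_left] using! this
  · intro i n m h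
    ext v
    rw [mul_apply_eq_comp, hB, hB, hcongr (m := n) (w := v) 1 fun x => by
      rw [rankOneKernel_apply_of_le hp hmono x h, mul_one]]
    rfl
  · intro i n d hd
    ext v
    rw [mul_apply_eq_comp, mul_apply_eq_comp, hB, hB, hcongr (star d) fun x =>
      rankOneKernel_apply_compressed hp hmono hcp hpD hbimod x n hd v,
      ContinuousLinearMap.adjoint_comp, ContinuousLinearMap.star_eq_adjoint,
      ContinuousLinearMap.adjoint_adjoint]
    rfl

end

section

variable {H : Type*} [NormedAddCommGroup H] [InnerProductSpace ℂ H] [CompleteSpace H]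

/-! ### Operators on the union of the ranges of an increasing sequence of projections -/

section UnionOperator

variable {p : ℕ → (H →L[ℂ] H)} (hp : ∀ n, IsStarProjection (p n)) (hmono : Monotone p)

include hp hmono in
theorem mem_iSup_range_iff {ξ : H} :
    ξ ∈ (⨆ n, LinearMap.range (p n : H →ₗ[ℂ] H)) ↔ ∃ n, p n ξ = ξ := by
  rw [Submodule.mem_iSup_of_directed]
  · refine exists_congr fun n => ⟨?_, fun h => ⟨ξ, h⟩⟩
    rintro ⟨η, rfl⟩
    exact (hp n).apply_apply η
  · refine Monotone.directed_le fun n m h => ?_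
    rintro _ ⟨w, rfl⟩
    exact ⟨p n w, apply_apply_of_le hp hmono h w⟩

include hp hmono in
theorem apply_eq_self_of_le {n m : ℕ} (h : n ≤ m) {ξ : H} (hξ : p n ξ = ξ) : p m ξ = ξ := by
  rw [← hξ, apply_apply_of_le hp hmono h]

include hp hmono in
theorem apply_mem_iSup_range (n : ℕ) (ξ : H) :
    p n ξ ∈ (⨆ n, LinearMap.range (p n : H →ₗ[ℂ] H)) :=
  (mem_iSup_range_iff hp hmono).2 ⟨n, (hp n).apply_apply ξ⟩

variable {A : ℕ → (H →L[ℂ] H)} (hA : ∀ n m, n ≤ m → A m * p n = A n)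

include hA in
theorem apply_eq_of_compatible {n m : ℕ} {ξ : H} (hn : p n ξ = ξ) (hm : p m ξ = ξ) :
    A n ξ = A m ξ := by
  wlog h : n ≤ m
  · exact (this hA hm hn (le_of_not_ge h)).symm
  rw [← hA n m h, mul_apply_eq_comp, hn]

/-- The operator on the union of the ranges of the projections `p n` which restricts to `A n` on
the range of `p n`. -/
noncomputable def unionOperator : H →ₗ.[ℂ] H where
  domain := ⨆ n, LinearMap.range (p n : H →ₗ[ℂ] H)
  toFun :=
    { toFun := fun ξ => A ((mem_iSup_range_iff hp hmono).1 ξ.2).choose ξ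
      map_add' := fun ξ η => by
        have h := fun ξ : (⨆ n, LinearMap.range (p n : H →ₗ[ℂ] H) : Submodule ℂ H) =>
          ((mem_iSup_range_iff hp hmono).1 ξ.2).choose_spec
        obtain ⟨N, h1, h2⟩ : ∃ N, p N (ξ : H) = ξ ∧ p N (η : H) = η :=
          ⟨max _ _, apply_eq_self_of_le hp hmono (le_max_left _ _) (h ξ),
            apply_eq_self_of_le hp hmono (le_max_right _ _) (h η)⟩
        rw [apply_eq_of_compatible hA (h ξ) h1, apply_eq_of_compatible hA (h η) h2, ← map_add]
        exact apply_eq_of_compatible hA (h (ξ + η))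
          (by rw [Submodule.coe_add, map_add, h1, h2])
      map_smul' := fun c ξ => by
        have h := fun ξ : (⨆ n, LinearMap.range (p n : H →ₗ[ℂ] H) : Submodule ℂ H) =>
          ((mem_iSup_range_iff hp hmono).1 ξ.2).choose_spec
        rw [apply_eq_of_compatible hA (h (c • ξ))
          (m := ((mem_iSup_range_iff hp hmono).1 ξ.2).choose) (by simp [h ξ])]
        simp }

theorem unionOperator_domain :
    (unionOperator hp hmono hA).domain = ⨆ n, LinearMap.range (p n : H →ₗ[ℂ] H) :=
  rfl

theorem unionOperator_apply (ξ : (unionOperator hp hmono hA).domain) {n : ℕ}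
    (h : p n (ξ : H) = ξ) : unionOperator hp hmono hA ξ = A n ξ :=
  apply_eq_of_compatible hA ((mem_iSup_range_iff hp hmono).1 ξ.2).choose_spec h

theorem apply_mem_unionOperator_domain (n : ℕ) (ξ : H) :
    p n ξ ∈ (unionOperator hp hmono hA).domain :=
  apply_mem_iSup_range hp hmono n ξ

theorem unionOperator_apply_apply (n : ℕ) (ξ : H) :
    unionOperator hp hmono hA ⟨p n ξ, apply_mem_unionOperator_domain hp hmono hA n ξ⟩ = A n ξ := by
  rw [unionOperator_apply hp hmono hA _ ((hp n).apply_apply ξ), ← mul_apply_eq_comp, hA n n le_rfl]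

theorem exists_eq_apply_of_mem_domain (ξ : (unionOperator hp hmono hA).domain) :
    ∃ n, p n (ξ : H) = ξ :=
  (mem_iSup_range_iff hp hmono).1 ξ.2

theorem dense_unionOperator_domain
    (hsup : (⨆ n, LinearMap.range (p n : H →ₗ[ℂ] H)).topologicalClosure = ⊤) :
    Dense ((unionOperator hp hmono hA).domain : Set H) := by
  rw [unionOperator_domain, Submodule.dense_iff_topologicalClosure_eq_top, hsup]

variable (hA' : ∀ n m, n ≤ m → p n * A m = A n)

include hp hA' in
theorem adjoint_compatible (n m : ℕ) (h : n ≤ m) :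
    ContinuousLinearMap.adjoint (A m) * p n = ContinuousLinearMap.adjoint (A n) := by
  rw [← hA' n m h, ← ContinuousLinearMap.star_eq_adjoint, ← ContinuousLinearMap.star_eq_adjoint,
    star_mul, (hp n).isSelfAdjoint.star_eq]

theorem unionOperator_isFormalAdjoint :
    (unionOperator hp hmono hA).IsFormalAdjoint
      (unionOperator hp hmono (adjoint_compatible hp hA')) := by
  intro η ξ
  obtain ⟨n, hn⟩ := exists_eq_apply_of_mem_domain hp hmono _ ξ
  obtain ⟨m, hm⟩ := exists_eq_apply_of_mem_domain hp hmono _ η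
  have hn' := apply_eq_self_of_le hp hmono (le_max_left n m) hn
  have hm' := apply_eq_self_of_le hp hmono (le_max_right n m) hm
  rw [unionOperator_apply hp hmono _ ξ hn', unionOperator_apply hp hmono _ η hm']
  exact (ContinuousLinearMap.adjoint_inner_right _ _ _).symm

variable (hsup : (⨆ n, LinearMap.range (p n : H →ₗ[ℂ] H)).topologicalClosure = ⊤)
include hsup hA'

/-- The operator is contained in the adjoint of the union operator of the A(n)*, and an adjoint is
closed. -/
theorem unionOperator_isClosable : (unionOperator hp hmono hA).IsClosable := by
  have hd := dense_unionOperator_domain hp hmono (adjoint_compatible hp hA') hsup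
  exact (LinearPMap.adjoint_isClosed hd).isClosable.leIsClosable
    ((unionOperator_isFormalAdjoint hp hmono hA hA').symm.le_adjoint hd)

theorem unionOperator_adjoint_apply (n : ℕ) (ξ : H) :
    ∃ h : p n ξ ∈ (unionOperator hp hmono hA)†.domain,
      (unionOperator hp hmono hA)† ⟨p n ξ, h⟩ = ContinuousLinearMap.adjoint (A n) ξ := by
  have hle := (unionOperator_isFormalAdjoint hp hmono hA hA').le_adjoint
    (dense_unionOperator_domain hp hmono hA hsup)
  refine ⟨hle.1 (apply_mem_iSup_range hp hmono n ξ), ?_⟩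
  rw [← unionOperator_apply_apply hp hmono (adjoint_compatible hp hA') n ξ]
  exact (hle.2 rfl).symm

theorem unionOperator_isAffiliated {D : StarSubalgebra ℂ (H →L[ℂ] H)} (hpD : ∀ n, p n ∈ D)
    (hc : ∀ n, ∃ c ∈ commutantVN D, c * p n = A n) :
    IsAffiliated (commutantVN D) (unionOperator hp hmono hA) := by
  have hcl := unionOperator_isClosable hp hmono hA hA' hsup
  refine ⟨dense_unionOperator_domain hp hmono hA hsup, hcl, fun y hy ξ => ?_⟩
  have hy' := VonNeumannAlgebra.mem_commutant_iff.1 hy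
  -- The vector y η may leave the domain, but pₘ y η does not, and a(pₘ y η) = pₘ y (a η) for large
  -- m; letting m → ∞ puts (y η, y (a η)) in the closure of the graph.
  have hmaps : Set.MapsTo (Prod.map y y) ((unionOperator hp hmono hA).graph : Set (H × H))
      (closure ((unionOperator hp hmono hA).graph : Set (H × H))) := by
    rintro ⟨_, _⟩ hg
    obtain ⟨η, rfl, rfl⟩ := LinearPMap.mem_graph_iff _ |>.1 hg
    obtain ⟨n, hn⟩ := exists_eq_apply_of_mem_domain hp hmono hA η
    have hlim := fun v => tendsto_projection hp hmono hsup (y v)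
    refine mem_closure_of_tendsto ((hlim η).prodMk_nhds
      (hlim (unionOperator hp hmono hA η))) ?_
    filter_upwards [eventually_ge_atTop n] with m hm
    refine (LinearPMap.mem_graph_iff _).2
      ⟨⟨p m (y η), apply_mem_unionOperator_domain hp hmono hA m _⟩, rfl, ?_⟩
    have hηm := apply_eq_self_of_le hp hmono hm hn
    obtain ⟨c, hcD, hcA⟩ := hc m
    rw [unionOperator_apply_apply, unionOperator_apply hp hmono hA η hηm, ← hcA]
    have h1 : (c * p m) (y η) = p m (y (c η)) := by
      rw [← mem_commutantVN_iff.1 hcD _ (hpD m), mul_apply_eq_comp, ← mul_apply_eq_comp c y,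
        hy' c hcD, mul_apply_eq_comp]
    rw [h1, mul_apply_eq_comp c (p m), hηm]
  have hmem : (y (ξ : H), y ((unionOperator hp hmono hA).closure ξ)) ∈
      (unionOperator hp hmono hA).closure.graph := by
    have hξ := LinearPMap.mem_graph _ ξ
    rw [← hcl.graph_closure_eq_closure_graph] at hξ ⊢
    have := hmaps.closure_of_continuousOn (by fun_prop) hξ
    rwa [closure_closure] at this
  obtain ⟨η, h1, h2⟩ := (LinearPMap.mem_graph_iff _).1 hmem
  have h1 : (η : H) = y ξ := h1
  refine ⟨h1 ▸ η.2, (congrArg _ (Subtype.ext h1.symm)).trans h2⟩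

end UnionOperator

end

section

variable {H : Type*} [NormedAddCommGroup H] [InnerProductSpace ℂ H]

/-! ### From rank one operators to compact operators -/

theorem norm_inner_apply_le (x : H →L[ℂ] H) (a b : H) :
    ‖inner ℂ a (x b)‖ ≤ ‖x‖ * (‖a‖ ^ 2 + ‖b‖ ^ 2) := by
  calc ‖inner ℂ a (x b)‖ ≤ ‖a‖ * (‖x‖ * ‖b‖) :=
        (norm_inner_le_norm _ _).trans (by gcongr; exact x.le_opNorm _)
    _ = ‖x‖ * (‖a‖ * ‖b‖) := by ring
    _ ≤ _ := by
        gcongr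
        nlinarith [sq_nonneg (‖a‖ - ‖b‖), sq_nonneg ‖a‖, sq_nonneg ‖b‖]

/-- The functional `x ↦ ⟪a, x b⟫`. -/
noncomputable def vectorFunctional (a b : H) : (H →L[ℂ] H) →L[ℂ] ℂ :=
  (innerSL ℂ a).comp (ContinuousLinearMap.apply ℂ H b)

theorem norm_vectorFunctional_le (a b : H) : ‖vectorFunctional a b‖ ≤ ‖a‖ ^ 2 + ‖b‖ ^ 2 :=
  ContinuousLinearMap.opNorm_le_bound _ (by positivity) fun x =>
    (norm_inner_apply_le x a b).trans_eq (mul_comm _ _)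

theorem exists_clm_hasSum_inner {a b : ℕ → H} (hb : Summable fun i => ‖b i‖ ^ 2)
    (ha : Summable fun i => ‖a i‖ ^ 2) :
    ∃ T : (H →L[ℂ] H) →L[ℂ] ℂ, ∀ x, HasSum (fun i => inner ℂ (a i) (x (b i))) (T x) := by
  have hφ : Summable fun i => vectorFunctional (a i) (b i) :=
    Summable.of_norm_bounded (E := (H →L[ℂ] H) →L[ℂ] ℂ)
      (f := fun i => vectorFunctional (a i) (b i)) (ha.add hb) fun i => norm_vectorFunctional_le _ _
  refine ⟨∑' i, vectorFunctional (a i) (b i), fun x => ?_⟩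
  have h := hφ.hasSum.map (ContinuousLinearMap.apply ℂ ℂ x) (ContinuousLinearMap.continuous _)
  exact h

variable [CompleteSpace H]

/-! ### Square summability and weak* convergence of the Kraus series -/

section WeakStarSum

variable {Φ : (H →L[ℂ] H) → (H →L[ℂ] H)} {p : H →L[ℂ] H} (hp : IsStarProjection p)
  (hcp : IsCompletelyPositiveOn Φ p) {B : ℕ → (H →L[ℂ] H)}
  (hB : ∀ v w ξ η, HasSum (fun i => inner ℂ ξ (B i v) * inner ℂ (B i w) η)
    (inner ℂ ξ (Φ (rankOne ℂ (p v) (p w)) η)))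
include hp hcp hB

/-- Summing the expansion of Φ(p eⱼ ⊗ (p eⱼ)*) over j gives Φ(pP_U p), whose norm is at most C
whatever the dimension of U. -/
theorem sum_norm_inner_sq_le {C : ℝ} (hC0 : 0 ≤ C) (hC : ∀ x ∈ compactCorner p, ‖Φ x‖ ≤ C * ‖x‖)
    (s : Finset ℕ) {U : Submodule ℂ H} {ι : Type*} [Fintype ι] [U.HasOrthogonalProjection]
    (e : OrthonormalBasis ι ℂ U) (ξ : H) :
    ∑ i ∈ s, ∑ j, ‖inner ℂ (e j : H) (ContinuousLinearMap.adjoint (B i) ξ)‖ ^ 2 ≤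
      C * ‖ξ‖ ^ 2 := by
  let y : ι → compactCornerAlgebra hp := fun j =>
    ⟨rankOne ℂ (p (e j)) (p (e j)), rankOne_mem_compactCorner hp _ _⟩
  have h1 : ∀ j, HasSum (fun i => ‖inner ℂ (e j : H) (ContinuousLinearMap.adjoint (B i) ξ)‖ ^ 2)
      (inner ℂ ξ (Φ (y j) ξ)).re := by
    intro j
    convert Complex.hasSum_re (hB (e j) (e j) ξ ξ) using 2 with i
    rw [ContinuousLinearMap.adjoint_inner_right, ← inner_conj_symm ξ, Complex.conj_mul',
      ← Complex.ofReal_pow, Complex.ofReal_re]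
  have hy : ((∑ j, y j : compactCornerAlgebra hp) : H →L[ℂ] H) = p * U.starProjection * p := by
    rw [starProjection_eq_sum_rankOne e, Finset.mul_sum, Finset.sum_mul]
    rw [AddSubmonoidClass.coe_finsetSum]
    refine Finset.sum_congr rfl fun j _ => ?_
    ext v
    simp [y, hp.inner_apply]
  have hΦ : Φ (∑ j, y j : compactCornerAlgebra hp) = ∑ j, Φ (y j) :=
    map_sum (hcp.toLinearMap hp) y Finset.univ
  have hn : ‖p * U.starProjection * p‖ ≤ 1 := by
    refine norm_mul₃_le.trans ?_
    have h1 : ‖p‖ ≤ 1 := hp.norm_le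
    have h2 := U.starProjection_norm_le
    exact mul_le_one₀ (mul_le_one₀ h1 (norm_nonneg _) h2) (norm_nonneg _) h1
  rw [Finset.sum_comm]
  calc _ ≤ ∑ j, (inner ℂ ξ (Φ (y j) ξ)).re :=
        Finset.sum_le_sum fun j _ => sum_le_hasSum s (fun i _ => by positivity) (h1 j)
    _ = (inner ℂ ξ (Φ (∑ j, y j : compactCornerAlgebra hp) ξ)).re := by
        rw [hΦ, sum_apply, inner_sum, Complex.re_sum]
    _ ≤ ‖ξ‖ * ‖Φ (∑ j, y j : compactCornerAlgebra hp) ξ‖ :=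
        (Complex.re_le_norm _).trans (norm_inner_le_norm _ _)
    _ ≤ ‖ξ‖ * (C * 1 * ‖ξ‖) := by
        gcongr
        refine ContinuousLinearMap.le_of_opNorm_le _ ?_ _
        refine (hC _ (∑ j, y j).2).trans ?_
        rw [hy]
        gcongr
    _ = C * ‖ξ‖ ^ 2 := by ring

theorem exists_sum_norm_adjoint_sq_le : ∃ C : ℝ, 0 ≤ C ∧ ∀ (s : Finset ℕ) (ξ : H),
    ∑ i ∈ s, ‖ContinuousLinearMap.adjoint (B i) ξ‖ ^ 2 ≤ C * ‖ξ‖ ^ 2 := by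
  obtain ⟨C, hC0, hC⟩ := hcp.exists_norm_map_le hp
  refine ⟨C, hC0, fun s ξ => ?_⟩
  -- With U containing every Bᵢ*ξ for i ∈ s, the inner sums over j become the full norms ‖Bᵢ*ξ‖².
  let U : Submodule ℂ H :=
    Submodule.span ℂ ((fun i => ContinuousLinearMap.adjoint (B i) ξ) '' (s : Set ℕ))
  have : FiniteDimensional ℂ U := .span_of_finite ℂ (s.finite_toSet.image _)
  have h := sum_norm_inner_sq_le hp hcp hB hC0 hC s (stdOrthonormalBasis ℂ U) ξ
  refine le_trans (le_of_eq (Finset.sum_congr rfl fun i hi => ?_)) h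
  exact ((stdOrthonormalBasis ℂ U).sum_sq_norm_inner_right
    ⟨ContinuousLinearMap.adjoint (B i) ξ, Submodule.subset_span ⟨i, hi, rfl⟩⟩).symm

/-- By square summability the series defines a bounded functional of x; it agrees with ⟪η, Φ(x)ξ⟫ on
the span of rank ones, and both are norm continuous on the corner. -/
theorem hasSum_inner_mul_adjoint {x : H →L[ℂ] H} (hx : x ∈ compactCorner p) (ξ η : H) :
    HasSum (fun i => inner ℂ η ((B i * x * ContinuousLinearMap.adjoint (B i)) ξ))
      (inner ℂ η (Φ x ξ)) := by
  obtain ⟨C, hC0, hC⟩ := exists_sum_norm_adjoint_sq_le hp hcp hB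
  obtain ⟨C', hC'0, hC'⟩ := hcp.exists_norm_map_le hp
  let A := fun i => ContinuousLinearMap.adjoint (B i)
  have hsum : ∀ ξ, Summable fun i => ‖A i ξ‖ ^ 2 := fun ξ =>
    summable_of_sum_le (fun i => by positivity) fun s => hC s ξ
  obtain ⟨T, hT⟩ := exists_clm_hasSum_inner (hsum ξ) (hsum η)
  have hφ : ∀ i (x : H →L[ℂ] H), inner ℂ (A i η) (x (A i ξ)) =
      inner ℂ η ((B i * x * ContinuousLinearMap.adjoint (B i)) ξ) := fun i x =>
    ContinuousLinearMap.adjoint_inner_left _ _ _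
  have hspan : ∀ x ∈ rankOneSpan p, T x = inner ℂ η (Φ x ξ) := by
    intro x hx
    induction hx using Submodule.span_induction with
    | mem x hx =>
      obtain ⟨w, rfl⟩ := hx
      refine (hT _).unique ?_
      have := hB (p w.1) (p w.2) η ξ
      rw [hp.apply_apply, hp.apply_apply] at this
      convert this using 2 with i
      rw [rankOne_apply, inner_smul_right, mul_comm, ContinuousLinearMap.adjoint_inner_left,
        ContinuousLinearMap.adjoint_inner_right]
    | zero => simp [hcp.map_zero hp]
    | add x y hx hy h1 h2 =>
      rw [map_add, h1, h2, hcp.map_add _ (rankOneSpan_le hp hx) _ (rankOneSpan_le hp hy),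
        add_apply, inner_add_right]
    | smul c x hx h =>
      rw [map_smul, h, hcp.map_smul _ _ (rankOneSpan_le hp hx), smul_apply, inner_smul_right,
        smul_eq_mul]
  obtain ⟨y, hy, hyx⟩ := mem_closure_iff_seq_limit.1
    (compactCorner_subset_closure_rankOneSpan p hp hx)
  have hΦ : Tendsto (fun k => Φ (y k)) atTop (𝓝 (Φ x)) := by
    rw [tendsto_iff_norm_sub_tendsto_zero] at hyx ⊢
    refine squeeze_zero (fun _ => norm_nonneg _) (fun k => ?_)
      (by simpa using hyx.const_mul C')
    have hk : y k ∈ compactCorner p := rankOneSpan_le hp (hy k)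
    have hsub : Φ (y k - x) = Φ (y k) - Φ x := map_sub (hcp.toLinearMap hp) ⟨y k, hk⟩ ⟨x, hx⟩
    rw [← hsub]
    exact hC' _ (sub_mem (S := Submodule ℂ (H →L[ℂ] H)) (H := compactCornerSubmodule p) hk hx)
  have hlim : T x = inner ℂ η (Φ x ξ) := by
    refine tendsto_nhds_unique ((T.continuous.tendsto x).comp hyx) ?_
    have h2 : Continuous fun z : H →L[ℂ] H => inner ℂ η (z ξ) := by fun_prop
    exact ((h2.tendsto _).comp hΦ).congr fun k => (hspan _ (hy k)).symm
  rw [← hlim]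
  simpa only [hφ] using hT x

/-- The double series over vectors k and coefficients i converges absolutely, so the two sums may be
interchanged. -/
theorem hasWeakStarSum_mul_adjoint {x : H →L[ℂ] H} (hx : x ∈ compactCorner p) :
    HasWeakStarSum (fun i => B i * x * ContinuousLinearMap.adjoint (B i)) (Φ x) := by
  intro ξ η hξ hη
  obtain ⟨C, hC0, hC⟩ := exists_sum_norm_adjoint_sq_le hp hcp hB
  have hsum : ∀ ζ : ℕ → H, Summable (fun k => ‖ζ k‖ ^ 2) →
      Summable fun q : ℕ × ℕ => ‖ContinuousLinearMap.adjoint (B q.2) (ζ q.1)‖ ^ 2 := by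
    intro ζ hζ
    refine (summable_prod_of_nonneg fun _ => by positivity).2 ⟨fun k => ?_, ?_⟩
    · exact summable_of_sum_le (fun i => by positivity) fun s => hC s (ζ k)
    · refine Summable.of_nonneg_of_le (fun k => tsum_nonneg fun i => by positivity) (fun k => ?_)
        (hζ.mul_left C)
      exact Real.tsum_le_of_sum_le (fun i => by positivity) fun s => hC s (ζ k)
  have hF : Summable fun q : ℕ × ℕ => inner ℂ (η q.1)
      ((B q.2 * x * ContinuousLinearMap.adjoint (B q.2)) (ξ q.1)) := by
    refine Summable.of_norm_bounded (((hsum η hη).add (hsum ξ hξ)).mul_left ‖x‖) fun q => ?_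
    simp only [mul_apply_eq_comp]
    rw [← ContinuousLinearMap.adjoint_inner_left]
    exact norm_inner_apply_le x _ _
  have h1 := hF.hasSum.prod_fiberwise fun k => hasSum_inner_mul_adjoint hp hcp hB hx (ξ k) (η k)
  rw [h1.tsum_eq]
  exact ((Equiv.prodComm ℕ ℕ).hasSum_iff.2 hF.hasSum).prod_fiberwise
    fun i => (hF.prod_symm.prod_factor i).hasSum

end WeakStarSum

end

/-! ### The factorisation theorem -/

theorem theorem3p5 {H : Type*} [NormedAddCommGroup H] [InnerProductSpace ℂ H] [CompleteSpace H]
    [TopologicalSpace.SeparableSpace H]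
    (D : StarSubalgebra ℂ (H →L[ℂ] H)) (hD : IsClosed (D : Set (H →L[ℂ] H)))
    (p : ℕ → (H →L[ℂ] H)) (hpD : ∀ n, p n ∈ D) (hp : ∀ n, IsStarProjection (p n))
    (hmono : Monotone p)
    (hsup : (⨆ n, LinearMap.range (p n : H →ₗ[ℂ] H)).topologicalClosure = ⊤)
    -- only the values of `Φ` on the union of the spaces `K(p n H)` matter
    (Φ : (H →L[ℂ] H) → (H →L[ℂ] H))
    (hcp : ∀ n, IsCompletelyPositiveOn Φ (p n))
    (hbimod : ∀ n, IsBimodularOn Φ (compressedAlgebra D (p n)) (compactCorner (p n))) :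
    ∃ a : ℕ → (H →ₗ.[ℂ] H),
      (∀ i, (a i).IsClosable ∧ IsAffiliated (commutantVN D) (a i)) ∧
      (∀ x ∈ ⋃ n, compactCorner (p n), ∃ t : ℕ → (H →L[ℂ] H),
        (∀ i, IsBoundedExtension (a i) x (t i)) ∧ HasWeakStarSum t (Φ x)) ∧
      (∀ i n, ∃ c ∈ commutantVN D, ∀ ξ : H,
        ∃ h : p n ξ ∈ (a i).domain, a i ⟨p n ξ, h⟩ = c (p n ξ)) := by
  obtain ⟨B, hsum, hright, hcent⟩ := exists_rankOne_expansion hp hmono hcp hpD hbimod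
  -- For n ≤ m, pₙ = pₘpₙpₘ lies in pₘDpₘ and therefore commutes with `B i m`.
  have hleft : ∀ i n m, n ≤ m → p n * B i m = B i n := fun i n m h => by
    rw [hcent i m (p n) ⟨p n, hpD n, by
      rw [mul_eq_right_of_monotone hp hmono h, mul_eq_left_of_monotone hp hmono h]⟩, hright i n m h]
  let A : ℕ → ℕ → (H →L[ℂ] H) := fun i n => ContinuousLinearMap.adjoint (B i n)
  have hA : ∀ i n m, n ≤ m → A i m * p n = A i n := fun i => adjoint_compatible hp (hleft i)
  have hA' : ∀ i n m, n ≤ m → p n * A i m = A i n := fun i n m h => by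
    simp only [A, ← ContinuousLinearMap.star_eq_adjoint]
    rw [← hright i n m h, star_mul, (hp n).isSelfAdjoint.star_eq]
  have hc : ∀ i n, ∃ c ∈ commutantVN D, c * p n = A i n := fun i n => by
    have hcen : A i n ∈ Set.centralizer (compressedAlgebra D (p n)) := by
      refine Set.star_mem_centralizer' (fun y hy => ?_) (hcent i n)
      rwa [← star_compressedAlgebra D (hp n), Set.star_mem_star]
    obtain ⟨c, hcD, h⟩ := exists_commutant_mul_eq (hp n) hcen
    exact ⟨c, hcD, h.trans (hA i n n le_rfl)⟩
  refine ⟨fun i => unionOperator hp hmono (hA i), fun i =>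
    ⟨unionOperator_isClosable hp hmono (hA i) (hA' i) hsup,
      unionOperator_isAffiliated hp hmono (hA i) (hA' i) hsup hpD (hc i)⟩, ?_, ?_⟩
  · intro x hx
    obtain ⟨n, hx⟩ := Set.mem_iUnion.1 hx
    refine ⟨fun i => B i n * x * ContinuousLinearMap.adjoint (B i n), fun i ξ => ?_,
      hasWeakStarSum_mul_adjoint (hp n) (hcp n) (hsum n) hx⟩
    obtain ⟨m, hm⟩ := exists_eq_apply_of_mem_domain hp hmono (hA i) ξ
    have hN := apply_eq_self_of_le hp hmono (le_max_right n m) hm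
    have hxv : ∀ v, x v = p n (x (p n v)) := fun v => by
      nth_rw 1 [← hx.2]
      rfl
    -- As x = pₙxpₙ, only pₙaᵢξ = A i n ξ matters, however far out in the union ξ lies; the result
    -- is in Hₙ, hence in the domain of aᵢ*.
    have hxξ : x (unionOperator hp hmono (hA i) ξ) = p n (x (A i n ξ)) := by
      rw [unionOperator_apply hp hmono (hA i) ξ hN, ← hA' i n _ (le_max_left n m),
        mul_apply_eq_comp, ← hxv]
    obtain ⟨h, heq⟩ := unionOperator_adjoint_apply hp hmono (hA i) (hA' i) hsup n (x (A i n ξ))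
    refine ⟨hxξ ▸ h, ?_⟩
    simp only [hxξ]
    rw [heq]
    simp [A]
  · intro i n
    obtain ⟨c, hcD, hcA⟩ := hc i n
    refine ⟨c, hcD, fun ξ => ⟨apply_mem_unionOperator_domain hp hmono (hA i) n ξ, ?_⟩⟩
    rw [unionOperator_apply_apply, ← hcA, mul_apply_eq_comp]
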